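/- Let $A$ be a ring with $1\ne 0$ (not necessarily finite or commutative) endowed with an involution $*$, i.e. an anti-automorphism of order at most $2$, and let $F$ be a field. Let $V$ be a right $A$-module with a skew-hermitian form $h:V\times V\to A$ (linear in the second variable, $h(v,u)=-h(u,v)^*$) and a basis $u_1,\dots,u_n,v_1,\dots,v_n$ satisfying $h(u_i,u_j)=h(v_i,v_j)=0$, $h(u_i,v_j)=\delta_{ij}$, $h(v_i,u_j)=-\delta_{ij}$. Put $M=\langle u_1,\dots,u_n\rangle$ and $N=\langle v_1,\dots,v_n\rangle$ ($A$-spans), and let $U\le \mathrm{GL}(V_A)$ be the group of isometries of $h$. Let $C$ be the pointwise stabilizer of $M$ in $U$, let $T$ be the global stabilizer of $M$ and $N$ in $U$, let $L$ be the group of all $g\in T$ with $gu_i\equiv u_i \bmod \langle u_1,\dots,u_{i-1}\rangle$ for $1\le i\le n$, and let $P=C\rtimes L$. A linear character $\lambda:A^+\to F^*$ is called left admissible if $(0)$ is the only left ideal of $A$ contained in the kernel of $a\mapsto\lambda(a+a^*)$. For $w\in N$ let $L_w$ be the stabilizer of $w$ in $L$; for a linear character $\lambda:A^+\to F^*$,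 let $\chi_{w,\lambda}: C\rtimes L_w\to F^*$ be the linear character $g\mapsto \lambda(h(gw,w))$. For $1\le i\le n$ let $V_{i,\lambda}=\mathrm{Ind}_{C\rtimes L_{v_i}}^{P}W_i$, where $W_i$ is a 1-dimensional module over $F$ on which $C\rtimes L_{v_i}$ acts via $\chi_{v_i,\lambda}$. Here induction from a subgroup $H\le G$ means $FG\otimes_{FH}(-)$. Let $D$ be any non-empty subset of $\{1,\dots,n\}$ and, for each $i\in D$, let $\lambda_i:A^+\to F^*$ be a left admissible linear character. Let $V(D,\lambda)=\bigotimes_{i\in D}V_{i,\lambda_i}$ (tensor product over $F$, diagonal action of $P$), let $L_D$ be the pointwise stabilizer of $\{v_i: i\in D\}$ in $L$, and let $M_D$ be the subgroup generated by $C$ and $L_D$. Then $$M_D=C\rtimes L_D=C\rtimes\bigcap_{i\in D}L_{v_i}=\bigcap_{i\in D}(C\rtimes L_{v_i}).$$ Moreover, let $\chi_{D,\lambda}:M_D\to F^*$ be the linear character $\chi_{D,\lambda}(g)=\prod_{i\in D}\lambda_i(h(gv_i,v_i))$, and let $Z_D$ be a 1-dimensional module over $F$ on which $M_D$ acts via $\chi_{D,\lambda}$.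 Then there is an isomorphism of $P$-modules $$V(D,\lambda)\cong \mathrm{Ind}_{M_D}^{P} Z_D.$$ -/

import Mathlib

open scoped TensorProduct

noncomputable section

/-- A right `A`-module `V` with a skew-hermitian form `h : V × V → A` (linear in the second
variable) and a basis `u_1, …, u_n, v_1, …, v_n` (`u_i = basis (inl i)`, `v_i = basis (inr i)`)
with Gram matrix `[[0, 1], [-1, 0]]`. Right `A`-modules are modules over `Aᵐᵒᵖ`. -/
structure SkewHermitianSpace (A : Type*) [Ring A] [StarRing A] (V : Type*) [AddCommGroup V]
    [Module Aᵐᵒᵖ V] (n : ℕ) where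
  form : V → V →ₗ[Aᵐᵒᵖ] A
  form_skew : ∀ u v, form v u = -star (form u v)
  basis : Module.Basis (Fin n ⊕ Fin n) Aᵐᵒᵖ V
  gram : (Matrix.of fun i j => form (basis i) (basis j)) = Matrix.fromBlocks 0 1 (-1) 0

/-- A linear character `lam : A⁺ → F*` is left admissible if the kernel of `a ↦ lam (a + a*)`
contains no nonzero left ideal. (`Ideal A` is the type of left ideals.) -/
def LeftAdmissible {A F : Type*} [Ring A] [StarRing A] [Field F] (lam : AddChar A Fˣ) : Prop :=
  ∀ I : Ideal A, (∀ a ∈ I, lam (a + star a) = 1) → I = ⊥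

/-- `G` is the internal semidirect product of its normal subgroup `K` and its subgroup `H`. -/
def IsInternalSemidirect {Γ : Type*} [Group Γ] (K H G : Subgroup Γ) : Prop :=
  K ⊔ H = G ∧ K ⊓ H = ⊥ ∧ ∀ g ∈ G, ∀ k ∈ K, g * k * g⁻¹ ∈ K

/-- The 1-dimensional representation on `F` afforded by a linear character. -/
def charRep {F G : Type*} [Field F] [Group G] (χ : G →* Fˣ) : Representation F G F where
  toFun g := (χ g : F) • LinearMap.id
  map_one' := by ext; simp
  map_mul' g g' := by ext; simp [mul_comm]

/-- The tensor product of a family of representations of `G`, with the diagonal action. -/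
def piTensorRep {F G ι : Type*} [Field F] [Group G] {W : ι → Type*}
    [∀ i, AddCommGroup (W i)] [∀ i, Module F (W i)] (ρ : ∀ i, Representation F G (W i)) :
    Representation F G (⨂[F] i, W i) where
  toFun g := PiTensorProduct.map fun i => ρ i g
  map_one' := by
    simp only [map_one]
    exact PiTensorProduct.map_one
  map_mul' g g' := by
    simp only [map_mul]
    exact PiTensorProduct.map_mul _ _

namespace SkewHermitianSpace

variable {A : Type*} [Ring A] [StarRing A] {V : Type*} [AddCommGroup V] [Module Aᵐᵒᵖ V] {n : ℕ}
  (S : SkewHermitianSpace A V n)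

def u (i : Fin n) : V := S.basis (Sum.inl i)

def v (i : Fin n) : V := S.basis (Sum.inr i)

/-- `M = ⟨u_1, …, u_n⟩`. -/
def spanU : Submodule Aᵐᵒᵖ V := Submodule.span Aᵐᵒᵖ (Set.range S.u)

/-- `N = ⟨v_1, …, v_n⟩`. -/
def spanV : Submodule Aᵐᵒᵖ V := Submodule.span Aᵐᵒᵖ (Set.range S.v)

/-- `⟨u_j | j < i⟩`. -/
def spanLT (i : Fin n) : Submodule Aᵐᵒᵖ V := Submodule.span Aᵐᵒᵖ (S.u '' Set.Iio i)

/-- The symplectic or unitary group `U`: the isometries of the form. -/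
def isometryGroup : Subgroup (V ≃ₗ[Aᵐᵒᵖ] V) where
  carrier := {g | ∀ x y, S.form (g x) (g y) = S.form x y}
  one_mem' := fun _ _ => rfl
  mul_mem' := fun {a b} ha hb x y => (ha (b x) (b y)).trans (hb x y)
  inv_mem' := fun {a} ha x y => by
    rw [← ha (a⁻¹ x) (a⁻¹ y)]
    exact congrArg₂ (fun p q => S.form p q) (a.apply_symm_apply x) (a.apply_symm_apply y)

/-- The global stabilizer of a submodule in `GL(V)`. -/
def globalStab (W : Submodule Aᵐᵒᵖ V) : Subgroup (V ≃ₗ[Aᵐᵒᵖ] V) where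
  carrier := {g | W.map (g : V →ₗ[Aᵐᵒᵖ] V) = W}
  one_mem' := Submodule.map_id W
  mul_mem' := fun {a b} ha hb => by
    have := Submodule.map_comp (b : V →ₗ[Aᵐᵒᵖ] V) (a : V →ₗ[Aᵐᵒᵖ] V) W
    have ha' : W.map (a : V →ₗ[Aᵐᵒᵖ] V) = W := ha
    have hb' : W.map (b : V →ₗ[Aᵐᵒᵖ] V) = W := hb
    rw [hb', ha'] at this
    exact this
  inv_mem' := fun {a} ha => by
    have ha' : W.map (a : V →ₗ[Aᵐᵒᵖ] V) = W := ha
    change W.map ((a.symm : V ≃ₗ[Aᵐᵒᵖ] V) : V →ₗ[Aᵐᵒᵖ] V) = W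
    conv_lhs => rw [← ha']
    rw [← Submodule.map_comp]
    simp

/-- The group `C`: the pointwise stabilizer of `M` in `U`. -/
def C : Subgroup (V ≃ₗ[Aᵐᵒᵖ] V) :=
  S.isometryGroup ⊓ fixingSubgroup (V ≃ₗ[Aᵐᵒᵖ] V) (S.spanU : Set V)

/-- The group `T`: the global stabilizer of `M` and `N` in `U`. -/
def T : Subgroup (V ≃ₗ[Aᵐᵒᵖ] V) :=
  S.isometryGroup ⊓ globalStab S.spanU ⊓ globalStab S.spanV

theorem u_mem_spanLT {i j : Fin n} (h : j < i) : S.u j ∈ S.spanLT i :=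
  Submodule.subset_span ⟨j, h, rfl⟩

theorem spanLT_mono {i j : Fin n} (h : j ≤ i) : S.spanLT j ≤ S.spanLT i :=
  Submodule.span_mono (Set.image_mono (Set.Iio_subset_Iio h))

theorem map_mem_spanLT (g : V ≃ₗ[Aᵐᵒᵖ] V) (i : Fin n)
    (hg : ∀ j < i, g (S.u j) - S.u j ∈ S.spanLT j) {x : V} (hx : x ∈ S.spanLT i) :
    g x ∈ S.spanLT i := by
  have : S.spanLT i ≤ (S.spanLT i).comap (g : V →ₗ[Aᵐᵒᵖ] V) := by
    refine Submodule.span_le.2 ?_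
    rintro _ ⟨j, hj, rfl⟩
    have h1 := S.spanLT_mono (le_of_lt hj) (hg j hj)
    have h2 := add_mem h1 (S.u_mem_spanLT hj)
    simpa using h2
  exact this hx

/-- The group `L`: all `g ∈ T` with `g u_i ≡ u_i` modulo `⟨u_1, …, u_{i-1}⟩` for all `i`. -/
def L : Subgroup (V ≃ₗ[Aᵐᵒᵖ] V) where
  carrier := {g | g ∈ S.T ∧ ∀ i, g (S.u i) - S.u i ∈ S.spanLT i}
  one_mem' := ⟨one_mem _, fun i => by simp⟩
  mul_mem' := fun {a b} ha hb => ⟨mul_mem ha.1 hb.1, fun i => by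
    have h1 := S.map_mem_spanLT a i (fun j _ => ha.2 j) (hb.2 i)
    have h2 := add_mem h1 (ha.2 i)
    simpa using h2⟩
  inv_mem' := fun {a} ha => ⟨inv_mem ha.1, fun i => by
    induction i using WellFoundedLT.induction with
    | ind i ih =>
      have h1 := S.map_mem_spanLT a⁻¹ i ih (ha.2 i)
      have h2 : a⁻¹ (a (S.u i)) = S.u i := a.symm_apply_apply _
      rw [map_sub, h2] at h1
      have h3 := neg_mem h1
      simpa using h3⟩

/-- `P = C ⋊ L`, as a subgroup of `GL(V)`. -/
def P : Subgroup (V ≃ₗ[Aᵐᵒᵖ] V) := S.C ⊔ S.L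

/-- `L_w`: the stabilizer of the vector `w` in `L`. -/
def stabL (w : V) : Subgroup (V ≃ₗ[Aᵐᵒᵖ] V) :=
  S.L ⊓ fixingSubgroup (V ≃ₗ[Aᵐᵒᵖ] V) {w}

/-- `C ⋊ L_w`. -/
def CL (w : V) : Subgroup (V ≃ₗ[Aᵐᵒᵖ] V) := S.C ⊔ S.stabL w

/-- `L_D`: the pointwise stabilizer of `{v_i | i ∈ D}` in `L`. -/
def LD (D : Finset (Fin n)) : Subgroup (V ≃ₗ[Aᵐᵒᵖ] V) :=
  S.L ⊓ fixingSubgroup (V ≃ₗ[Aᵐᵒᵖ] V) (S.v '' (D : Set (Fin n)))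

/-- `M_D = C ⋊ L_D`. -/
def MD (D : Finset (Fin n)) : Subgroup (V ≃ₗ[Aᵐᵒᵖ] V) := S.C ⊔ S.LD D

theorem CL_le_P (w : V) : S.CL w ≤ S.P := sup_le_sup_left inf_le_left _

theorem MD_le_P (D : Finset (Fin n)) : S.MD D ≤ S.P := sup_le_sup_left inf_le_left _

theorem MD_le_CL {D : Finset (Fin n)} {i : Fin n} (hi : i ∈ D) : S.MD D ≤ S.CL (S.v i) := by
  refine sup_le_sup_left (inf_le_inf_left _ ?_) _
  intro g hg
  rw [mem_fixingSubgroup_iff] at hg ⊢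
  rintro _ rfl
  exact hg _ ⟨i, hi, rfl⟩

theorem v_mem (i : Fin n) : S.v i ∈ S.spanV := Submodule.subset_span ⟨i, rfl⟩

theorem form_add_left (x y z : V) : S.form (x + y) z = S.form x z + S.form y z := by
  rw [S.form_skew z, S.form_skew z, S.form_skew z, map_add, star_add, neg_add]

theorem form_zero_of_span {s t : Set V} (h : ∀ x ∈ s, ∀ y ∈ t, S.form x y = 0) {x y : V}
    (hx : x ∈ Submodule.span Aᵐᵒᵖ s) (hy : y ∈ Submodule.span Aᵐᵒᵖ t) : S.form x y = 0 := by
  have h1 : ∀ x ∈ s, S.form x y = 0 := fun x hx => by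
    have : Submodule.span Aᵐᵒᵖ t ≤ LinearMap.ker (S.form x) := Submodule.span_le.2 (h x hx)
    exact this hy
  have h2 : Submodule.span Aᵐᵒᵖ s ≤ LinearMap.ker (S.form y) := by
    refine Submodule.span_le.2 fun z hz => ?_
    change S.form y z = 0
    rw [S.form_skew z y, h1 z hz]
    simp
  rw [S.form_skew y x, show S.form y x = 0 from h2 hx]
  simp

theorem form_basis (i j : Fin n ⊕ Fin n) :
    S.form (S.basis i) (S.basis j) = Matrix.fromBlocks 0 1 (-1) 0 i j := by
  rw [← S.gram]; rfl

theorem form_spanU {x y : V} (hx : x ∈ S.spanU) (hy : y ∈ S.spanU) : S.form x y = 0 :=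
  S.form_zero_of_span (by
    rintro _ ⟨i, rfl⟩ _ ⟨j, rfl⟩
    simpa [u] using S.form_basis (Sum.inl i) (Sum.inl j)) hx hy

theorem form_spanV {x y : V} (hx : x ∈ S.spanV) (hy : y ∈ S.spanV) : S.form x y = 0 :=
  S.form_zero_of_span (by
    rintro _ ⟨i, rfl⟩ _ ⟨j, rfl⟩
    simpa [v] using S.form_basis (Sum.inr i) (Sum.inr j)) hx hy

theorem mem_spanU_of_orthogonal {x : V} (h : ∀ i, S.form (S.u i) x = 0) : x ∈ S.spanU := by
  have key : ∀ i, S.basis.repr x (Sum.inr i) = 0 := fun i => by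
    have h1 := h i
    rw [← S.basis.sum_repr x, map_sum, Fintype.sum_sum_type] at h1
    simp only [map_smul, u, form_basis, Matrix.fromBlocks_apply₁₁, Matrix.fromBlocks_apply₁₂,
      Matrix.zero_apply, smul_zero, Finset.sum_const_zero, zero_add, Matrix.one_apply,
      smul_ite] at h1
    simpa using h1
  rw [← S.basis.sum_repr x, Fintype.sum_sum_type]
  simp only [key, zero_smul, Finset.sum_const_zero, add_zero]
  exact sum_mem fun i _ => Submodule.smul_mem _ _ (Submodule.subset_span ⟨i, rfl⟩)

/-- The isometries `g` with `g M = M` and `g w ≡ w` modulo `M`. -/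
def auxGroup (w : V) : Subgroup (V ≃ₗ[Aᵐᵒᵖ] V) where
  carrier := {g | g ∈ S.isometryGroup ⊓ globalStab S.spanU ∧ g w - w ∈ S.spanU}
  one_mem' := ⟨one_mem _, by simp⟩
  mul_mem' := fun {a b} ha hb => ⟨mul_mem ha.1 hb.1, by
    have h1 : a (b w - w) ∈ S.spanU := by
      have h0 : S.spanU.map (a : V →ₗ[Aᵐᵒᵖ] V) = S.spanU := ha.1.2
      rw [← h0]
      exact Submodule.mem_map_of_mem hb.2
    simpa using add_mem h1 ha.2⟩
  inv_mem' := fun {a} ha => ⟨inv_mem ha.1, by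
    have h1 : a⁻¹ (a w - w) ∈ S.spanU := by
      have h0 : S.spanU.map ((a⁻¹ : V ≃ₗ[Aᵐᵒᵖ] V) : V →ₗ[Aᵐᵒᵖ] V) = S.spanU := (inv_mem ha.1).2
      rw [← h0]
      exact Submodule.mem_map_of_mem ha.2
    rw [map_sub, show a⁻¹ (a w) = w from a.symm_apply_apply _] at h1
    simpa using neg_mem h1⟩

theorem CL_le_auxGroup (w : V) : S.CL w ≤ S.auxGroup w := by
  refine sup_le ?_ ?_
  · rintro g ⟨hU, hM⟩
    have hM' : ∀ y ∈ S.spanU, g y = y := fun y hy => (mem_fixingSubgroup_iff _).1 hM y hy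
    refine ⟨⟨hU, ?_⟩, S.mem_spanU_of_orthogonal fun i => ?_⟩
    · change S.spanU.map (g : V →ₗ[Aᵐᵒᵖ] V) = S.spanU
      ext y
      constructor
      · rintro ⟨z, hz, rfl⟩
        change g z ∈ S.spanU
        rw [hM' z hz]
        exact hz
      · exact fun hy => ⟨y, hy, hM' y hy⟩
    · have h1 := hU (S.u i) w
      rw [hM' (S.u i) (Submodule.subset_span ⟨i, rfl⟩)] at h1
      rw [map_sub, h1, sub_self]
  · rintro g ⟨hL, hw⟩
    refine ⟨hL.1.1, ?_⟩
    have : g w = w := (mem_fixingSubgroup_iff _).1 hw w rfl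
    simp [this]

theorem form_mul {w : V} (hw : w ∈ S.spanV) {g g' : V ≃ₗ[Aᵐᵒᵖ] V} (hg : g ∈ S.CL w)
    (hg' : g' ∈ S.CL w) : S.form ((g * g') w) w = S.form (g w) w + S.form (g' w) w := by
  have a := S.CL_le_auxGroup w hg
  have b := S.CL_le_auxGroup w hg'
  have c := S.CL_le_auxGroup w (inv_mem hg)
  have hiso : ∀ x, S.form (g x) w = S.form x (g⁻¹ w) := fun x => by
    rw [← a.1.1 x (g⁻¹ w)]
    exact congrArg (S.form (g x)) (g.apply_symm_apply w).symm
  have e1 : g' w = w + (g' w - w) := by abel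
  have e2 : g⁻¹ w = w + (g⁻¹ w - w) := by abel
  have hww := S.form_spanV hw hw
  have h0 := S.form_spanU b.2 c.2
  change S.form (g (g' w)) w = _
  rw [hiso, hiso, e1, e2]
  simp only [form_add_left, map_add, hww, h0]
  abel

/-- The linear character `χ_{w, lam}` of `C ⋊ L_w`, `g ↦ lam (h (g w, w))`, for `w ∈ N`. -/
def chi {F : Type*} [Field F] (w : V) (hw : w ∈ S.spanV) (lam : AddChar A Fˣ) :
    S.CL w →* Fˣ where
  toFun g := lam (S.form ((g : V ≃ₗ[Aᵐᵒᵖ] V) w) w)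
  map_one' := by
    change lam (S.form w w) = 1
    rw [S.form_spanV hw hw, AddChar.map_zero_eq_one]
  map_mul' g g' := by
    rw [← AddChar.map_add_eq_mul, ← S.form_mul hw g.2 g'.2]
    rfl

/-- The linear character `χ_{D, lam}` of `M_D`, `g ↦ ∏_{i ∈ D} lam_i (h (g v_i, v_i))`. -/
def chiD {F : Type*} [Field F] (D : Finset (Fin n)) (lam : D → AddChar A Fˣ) :
    S.MD D →* Fˣ where
  toFun g := ∏ i : D, lam i (S.form ((g : V ≃ₗ[Aᵐᵒᵖ] V) (S.v i)) (S.v i))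
  map_one' := Finset.prod_eq_one fun i _ => (S.chi (S.v i) (S.v_mem i) (lam i)).map_one
  map_mul' g g' := by
    rw [← Finset.prod_mul_distrib]
    exact Finset.prod_congr rfl fun i _ => (S.chi (S.v i) (S.v_mem i) (lam i)).map_mul
      (Subgroup.inclusion (S.MD_le_CL i.2) g) (Subgroup.inclusion (S.MD_le_CL i.2) g')

/-- The `P`-module `V_{i, lam}`, induced from the linear character `χ_{v_i, lam}` of
`C ⋊ L_{v_i}`. -/
def repV {F : Type*} [Field F] (i : Fin n) (lam : AddChar A Fˣ) :
    Representation F S.P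
      (Representation.IndV (Subgroup.inclusion (S.CL_le_P (S.v i)))
        (charRep (S.chi (S.v i) (S.v_mem i) lam))) :=
  Representation.ind (Subgroup.inclusion (S.CL_le_P (S.v i)))
    (charRep (S.chi (S.v i) (S.v_mem i) lam))

/-- The `P`-module `V(D, lam) = ⨂_{i ∈ D} V_{i, lam_i}`. -/
def repVD {F : Type*} [Field F] (D : Finset (Fin n)) (lam : D → AddChar A Fˣ) :
    Representation F S.P
      (⨂[F] i : D, Representation.IndV (Subgroup.inclusion (S.CL_le_P (S.v i)))
        (charRep (S.chi (S.v i) (S.v_mem i) (lam i)))) :=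
  piTensorRep fun i : D => S.repV (i : Fin n) (lam i)

/-- The monomial `P`-module `Ind_{M_D}^P Z_D`, where `Z_D` is 1-dimensional with `M_D` acting
via `χ_{D, lam}`. -/
def repInd {F : Type*} [Field F] (D : Finset (Fin n)) (lam : D → AddChar A Fˣ) :
    Representation F S.P
      (Representation.IndV (Subgroup.inclusion (S.MD_le_P D)) (charRep (S.chiD D lam))) :=
  Representation.ind (Subgroup.inclusion (S.MD_le_P D)) (charRep (S.chiD D lam))

end SkewHermitianSpace

end

/-!
The isomorphism is an instance of Mackey's tensor product theorem. If a group `P` acts transitively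
on the product of the coset spaces of subgroups `H i`, then the tensor product of the modules
induced from linear characters `χ i` of `H i` is induced from the product of these characters on
`⋂ H i`. Indeed, both modules are monomial: the induced module has a basis indexed by the cosets of
`⋂ H i`, the tensor product has one indexed by tuples of cosets of the `H i`, transitivity
identifies the two index sets, and the scalars agree (`indBasis`, `nonempty_equiv_piTensorRep_ind`).

Here `H i = C ⋊ L_{v_i}`. As `L` normalizes `C` and `C ⊓ L = ⊥` (`C_inf_L`), the `L`-component of an
element of `C ⋊ L_{v_i}` fixes `v_i`, which gives `M_D = ⋂ H i` (`MD_eq_iInf`), and a coset of `H i`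
in `P` amounts to a point in the `L`-orbit of `v_i`. The group `L` acts on `N` by unitriangular
matrices, so that this orbit lies in `v_i + ⟨v_j | j > i⟩` (`map_v_sub_mem_upperV`). Conversely, for
all `x_i ∈ ⟨v_j | j > i⟩` a single element of `L` sends every `v_i` to `v_i + x_i`
(`exists_mem_L_forall_map_v`): it is a product of Eichler transvections
`y ↦ y + x h(u_i, y) + u_i h(x, y)`, whose isometry property needs no matrix inversion over the
noncommutative ring `A`. This is the transitivity required.
-/

open scoped TensorProduct

noncomputable section

/-! ### Tensor products of monomial modules -/

namespace Representation

/-- Maps out of an induced module `Ind W` are families of linear maps `f x : W → B`, indexed by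
the elements `x` of the big group, with `f (φ h * x) ∘ ρ h = f x`. -/
def IndV.lift {k H G : Type*} [CommRing k] [Group H] [Group G] (φ : H →* G) {A B : Type*}
    [AddCommGroup A] [Module k A] (ρ : Representation k H A) [AddCommGroup B] [Module k B]
    (f : G → A →ₗ[k] B) (hf : ∀ h x a, f (φ h * x) (ρ h a) = f x a) : IndV φ ρ →ₗ[k] B :=
  Coinvariants.lift _
    (TensorProduct.lift ((Finsupp.lift _ _ _ f) ∘ₗ (MonoidAlgebra.coeffLinearEquiv k).toLinearMap))
    fun h => by
      ext x a
      simpa [ofMulAction_single] using hf h x a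

theorem IndV.lift_mk {k H G : Type*} [CommRing k] [Group H] [Group G] (φ : H →* G) {A B : Type*}
    [AddCommGroup A] [Module k A] (ρ : Representation k H A) [AddCommGroup B] [Module k B]
    (f : G → A →ₗ[k] B) (hf : ∀ h x a, f (φ h * x) (ρ h a) = f x a) (x : G) (a : A) :
    IndV.lift φ ρ f hf (IndV.mk φ ρ x a) = f x a := by
  simp [IndV.lift]

variable {F G : Type*} [Field F] [Group G]

section Monomial

variable {H κ : Type*} [Group H] (φ : H →* G) (χ : H →* Fˣ)

/-- `IndV.mk φ _ x` corresponds to `x⁻¹ ⊗ -` in `FG ⊗_{FH} F`, whence the inverse of `χ h` and the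
use of right cosets. -/
theorem IndV.mk_charRep_mul (h : H) (x : G) (a : F) :
    IndV.mk φ (charRep χ) (φ h * x) a = ((χ h)⁻¹ : Fˣ) • IndV.mk φ (charRep χ) x a := by
  have key := Coinvariants.mk_self_apply (tprod ((leftRegular F G).comp φ) (charRep χ)) h
    (MonoidAlgebra.single x 1 ⊗ₜ[F] a)
  have : IndV.mk φ (charRep χ) (φ h * x) (charRep χ h a) = IndV.mk φ (charRep χ) x a := by
    simpa [ofMulAction_single] using key
  rw [← this]
  change _ = ((χ h)⁻¹ : Fˣ) • IndV.mk φ (charRep χ) (φ h * x) ((χ h : F) • a)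
  rw [map_smul, ← Units.smul_def, inv_smul_smul]

/-- A module induced from a linear character has as a basis the vectors `IndV.mk φ _ x 1`, where `x`
runs over a right transversal `r` of the small group in the big group. -/
def indBasis (r : κ → G) (hr : Function.Bijective fun p : H × κ => φ p.1 * r p.2) :
    Module.Basis κ F (IndV φ (charRep χ)) :=
  let c := (Equiv.ofBijective _ hr).symm
  have hc : ∀ x, φ (c x).1 * r (c x).2 = x := (Equiv.ofBijective _ hr).apply_symm_apply
  have hc' : ∀ h q, c (φ h * r q) = (h, q) := fun h q =>
    (Equiv.ofBijective _ hr).symm_apply_apply (h, q)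
  .ofRepr <| LinearEquiv.ofLinearMap
    (IndV.lift φ (charRep χ)
      (fun x => (((χ (c x).1)⁻¹ : Fˣ) : F) • Finsupp.lsingle (c x).2)
      fun h x a => by
        have h1 : c (φ h * x) = (h * (c x).1, (c x).2) := by
          rw [← hc', map_mul φ, mul_assoc, hc]
        change (((χ (c (φ h * x)).1)⁻¹ : Fˣ) : F) • Finsupp.single (c (φ h * x)).2 ((χ h : F) • a) =
          (((χ (c x).1)⁻¹ : Fˣ) : F) • Finsupp.single (c x).2 a
        rw [h1, Finsupp.smul_single, Finsupp.smul_single, map_mul, mul_inv_rev, Units.val_mul,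
          smul_smul, mul_assoc, Units.inv_mul, mul_one])
    (Finsupp.linearCombination F fun q => IndV.mk φ (charRep χ) (r q) 1)
    (by
      ext q : 2
      have h1 : c (r q) = (1, q) := by rw [← hc', map_one, one_mul]
      rw [LinearMap.comp_apply, LinearMap.comp_apply, LinearMap.comp_apply, Finsupp.lsingle_apply,
        Finsupp.linearCombination_single, one_smul, IndV.lift_mk, h1]
      simp)
    (by
      refine IndV.hom_ext _ _ fun x => LinearMap.ext_ring ?_
      rw [LinearMap.comp_apply, LinearMap.comp_apply, IndV.lift_mk]
      conv_rhs => rw [LinearMap.comp_apply, ← hc x, IndV.mk_charRep_mul]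
      simp [Units.smul_def])

theorem indBasis_apply (r : κ → G) (hr : Function.Bijective fun p : H × κ => φ p.1 * r p.2)
    (q : κ) : indBasis φ χ r hr q = IndV.mk φ (charRep χ) (r q) 1 := by
  change Finsupp.linearCombination F (fun q => IndV.mk φ (charRep χ) (r q) 1)
    (Finsupp.single q 1) = _
  rw [Finsupp.linearCombination_single, one_smul]

theorem exists_right_transversal (hφ : Function.Injective φ) :
    ∃ r : Quotient (QuotientGroup.rightRel φ.range) → G,
      Function.Bijective fun p : H × Quotient (QuotientGroup.rightRel φ.range) =>
        φ p.1 * r p.2 := by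
  refine ⟨Quotient.out, ?_, fun x => ?_⟩
  · rintro ⟨h, q⟩ ⟨h', q'⟩ e
    have e : φ h * q.out = φ h' * q'.out := e
    have hq : q = q' := by
      rw [← q.out_eq, ← q'.out_eq, Quotient.eq, QuotientGroup.rightRel_apply]
      refine ⟨h'⁻¹ * h, ?_⟩
      rw [eq_mul_inv_iff_mul_eq, map_mul, map_inv, mul_assoc, e, inv_mul_cancel_left]
    subst hq
    rw [hφ (mul_right_cancel e)]
  · obtain ⟨h, hh⟩ := QuotientGroup.rightRel_apply.1
      (Quotient.mk_out (s := QuotientGroup.rightRel φ.range) x)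
    exact ⟨(h, Quotient.mk _ x), by simp [hh]⟩

end Monomial

/-- Mackey: a tensor product of modules induced from linear characters of subgroups `H i` is
induced from the product of these characters on `K = ⋂ H i`, provided that the big group acts
transitively on the product of the coset spaces of the `H i`. The subgroups are given as
injective homomorphisms. -/
theorem nonempty_equiv_piTensorRep_ind {ι K : Type*} [Fintype ι] {H : ι → Type*}
    [∀ i, Group (H i)] [Group K] (φ : ∀ i, H i →* G) (hφ : ∀ i, Function.Injective (φ i))
    (ψ : K →* G) (hψ : Function.Injective ψ) (α : ∀ i, K →* H i)
    (hα : ∀ i k, φ i (α i k) = ψ k) (hK : ∀ x, (∀ i, x ∈ (φ i).range) → x ∈ ψ.range)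
    (χ : ∀ i, H i →* Fˣ) (χK : K →* Fˣ) (hχ : ∀ k, χK k = ∏ i, χ i (α i k))
    (htrans : ∀ x : ι → G, ∃ g, ∀ i, ∃ h, g = φ i h * x i) :
    Nonempty ((piTensorRep fun i => ind (φ i) (charRep (χ i))).Equiv (ind ψ (charRep χK))) := by
  choose s hs using fun i => exists_right_transversal (φ i) (hφ i)
  -- A transversal of `K` indexed by the tuples of cosets of the `H i`: `r p` lies in every
  -- coset `p i`.
  choose r hr using fun p : ∀ i, Quotient (QuotientGroup.rightRel (φ i).range) =>
    htrans fun i => s i (p i)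
  choose h hh using hr
  have hrK : Function.Bijective fun p : K × _ => ψ p.1 * r p.2 := by
    refine ⟨?_, fun x => ?_⟩
    · rintro ⟨k, p⟩ ⟨k', p'⟩ e
      have e : ψ k * r p = ψ k' * r p' := e
      have hp : p = p' := funext fun i => by
        rw [hh p i, hh p' i, ← hα i, ← hα i, ← mul_assoc, ← mul_assoc, ← map_mul, ← map_mul] at e
        exact congrArg Prod.snd ((hs i).1 (a₁ := (_, p i)) (a₂ := (_, p' i)) e)
      subst hp
      rw [hψ (mul_right_cancel e)]
    · choose p hp using fun i => (hs i).2 x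
      obtain ⟨k, hk⟩ := hK (x * (r fun i => (p i).2)⁻¹) fun i =>
        ⟨(p i).1 * (h (fun i => (p i).2) i)⁻¹, by
          rw [hh _ i, ← hp i, map_mul, map_inv]
          group⟩
      exact ⟨(k, fun i => (p i).2), by simp [hk]⟩
  -- `mk (r p) 1` goes to the tensor product of the vectors `mk (r p) 1`, a basis vector up to a
  -- unit.
  let b := indBasis ψ χK r hrK
  let b' := (Basis.piTensorProduct fun i => indBasis (φ i) (χ i) (s i) (hs i)).unitsSMul
    fun p => ∏ i, (χ i (h p i))⁻¹
  let e := b.equiv b' (_root_.Equiv.refl _)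
  have he1 : ∀ p, e (IndV.mk ψ (charRep χK) (r p) 1) =
      PiTensorProduct.tprod F fun i => IndV.mk (φ i) (charRep (χ i)) (r p) 1 := fun p => by
    rw [← indBasis_apply ψ χK r hrK, Module.Basis.equiv_apply, _root_.Equiv.refl_apply,
      Module.Basis.unitsSMul_apply, Basis.piTensorProduct_apply, Units.smul_def, Units.coe_prod,
      ← MultilinearMap.map_smul_univ]
    congr 1
    funext i
    rw [indBasis_apply, hh p i, IndV.mk_charRep_mul, Units.smul_def]
  have he : ∀ x, e (IndV.mk ψ (charRep χK) x 1) =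
      PiTensorProduct.tprod F fun i => IndV.mk (φ i) (charRep (χ i)) x 1 := fun x => by
    obtain ⟨⟨k, p⟩, rfl⟩ := hrK.2 x
    have : (fun i => IndV.mk (φ i) (charRep (χ i)) (ψ k * r p) 1) =
        fun i => (((χ i (α i k))⁻¹ : Fˣ) : F) • IndV.mk (φ i) (charRep (χ i)) (r p) 1 :=
      funext fun i => by rw [← hα i, IndV.mk_charRep_mul, Units.smul_def]
    dsimp only
    rw [this, MultilinearMap.map_smul_univ, IndV.mk_charRep_mul, Units.smul_def, map_smul, he1,
      hχ, ← Finset.prod_inv_distrib, Units.coe_prod]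
  refine ⟨(Equiv.mk e fun g => ?_).symm⟩
  refine IndV.hom_ext _ _ fun x => LinearMap.ext_ring ?_
  change e (ind ψ (charRep χK) g (IndV.mk ψ (charRep χK) x 1)) =
    PiTensorProduct.map (fun i => ind (φ i) (charRep (χ i)) g) (e (IndV.mk ψ (charRep χK) x 1))
  rw [ind_mk, he, he, PiTensorProduct.map_tprod]
  simp only [ind_mk]

/-- The Mackey isomorphism `nonempty_equiv_piTensorRep_ind` for subgroups `H i` of a subgroup `P`
of an ambient group. -/
theorem nonempty_equiv_piTensorRep_ind_of_le {ι : Type*} [Fintype ι] {P K : Subgroup G}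
    {H : ι → Subgroup G} (hHP : ∀ i, H i ≤ P) (hKP : K ≤ P) (hKH : ∀ i, K ≤ H i)
    (hK : ∀ x, (∀ i, x ∈ H i) → x ∈ K) (χ : ∀ i, H i →* Fˣ) (χK : K →* Fˣ)
    (hχ : ∀ k, χK k = ∏ i, χ i (Subgroup.inclusion (hKH i) k))
    (htrans : ∀ x : ι → P, ∃ g : P, ∀ i, (x i : G) * g ∈ H i) :
    Nonempty ((piTensorRep fun i => ind (Subgroup.inclusion (hHP i)) (charRep (χ i))).Equiv
      (ind (Subgroup.inclusion hKP) (charRep χK))) := by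
  refine nonempty_equiv_piTensorRep_ind _ (fun i => Subgroup.inclusion_injective (hHP i)) _
    (Subgroup.inclusion_injective hKP) (fun i => Subgroup.inclusion (hKH i)) (fun _ _ => rfl)
    (fun x hx => ?_) χ χK hχ fun x => ?_
  · refine ⟨⟨x, hK x fun i => ?_⟩, rfl⟩
    obtain ⟨y, rfl⟩ := hx i
    exact y.2
  · obtain ⟨g, hg⟩ := htrans x
    exact ⟨g⁻¹, fun i => ⟨⟨_, hg i⟩⁻¹, Subtype.ext (by simp)⟩⟩

end Representation

/-! ### Stabilizers of submodules -/

namespace SkewHermitianSpace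

variable {A : Type*} [Ring A] {V : Type*} [AddCommGroup V] [Module Aᵐᵒᵖ V]

theorem map_mem_of_globalStab {W : Submodule Aᵐᵒᵖ V} {g : V ≃ₗ[Aᵐᵒᵖ] V} (hg : g ∈ globalStab W)
    {x : V} (hx : x ∈ W) : g x ∈ W :=
  (show W.map (g : V →ₗ[Aᵐᵒᵖ] V) = W from hg).le ⟨x, hx, rfl⟩

theorem mem_globalStab {W : Submodule Aᵐᵒᵖ V} {g : V ≃ₗ[Aᵐᵒᵖ] V} (h : ∀ x ∈ W, g x ∈ W)
    (h' : ∀ x ∈ W, g⁻¹ x ∈ W) : g ∈ globalStab W := by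
  refine le_antisymm (Submodule.map_le_iff_le_comap.2 h) fun x hx => ⟨g⁻¹ x, h' x hx, ?_⟩
  exact g.apply_symm_apply x

/-! ### Coordinates -/

variable [StarRing A] {n : ℕ} (S : SkewHermitianSpace A V n)

theorem u_mem (i : Fin n) : S.u i ∈ S.spanU := Submodule.subset_span ⟨i, rfl⟩

theorem form_u_u (i j : Fin n) : S.form (S.u i) (S.u j) = 0 := S.form_spanU (S.u_mem i) (S.u_mem j)

theorem form_u_v (i j : Fin n) : S.form (S.u i) (S.v j) = if i = j then 1 else 0 := by
  simp [u, v, form_basis, Matrix.one_apply]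

/-- The form pairs `M` and `N` non-degenerately. -/
theorem eq_zero_of_mem_spanV {x : V} (hx : x ∈ S.spanV) (h : ∀ i, S.form (S.u i) x = 0) :
    x = 0 := by
  -- `x` is orthogonal to all basis vectors
  have h' : ∀ i, S.form (S.v i) x = 0 := fun i => S.form_spanV (S.v_mem i) hx
  have h1 : ∀ i, S.basis.repr x (Sum.inl i) = 0 := fun i => by
    have h1 := h' i
    rw [← S.basis.sum_repr x, map_sum, Fintype.sum_sum_type] at h1
    simp only [map_smul, v, form_basis, Matrix.fromBlocks_apply₂₁, Matrix.fromBlocks_apply₂₂,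
      Matrix.zero_apply, smul_zero, Finset.sum_const_zero, add_zero, Matrix.one_apply,
      Matrix.neg_apply, smul_neg, smul_ite, Finset.sum_neg_distrib] at h1
    simpa using h1
  have h2 : ∀ i, S.basis.repr x (Sum.inr i) = 0 := fun i => by
    have h1 := h i
    rw [← S.basis.sum_repr x, map_sum, Fintype.sum_sum_type] at h1
    simp only [map_smul, u, form_basis, Matrix.fromBlocks_apply₁₁, Matrix.fromBlocks_apply₁₂,
      Matrix.zero_apply, smul_zero, Finset.sum_const_zero, zero_add, Matrix.one_apply,
      smul_ite] at h1
    simpa using h1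
  rw [← S.basis.sum_repr x, Fintype.sum_sum_type]
  simp [h1, h2]

theorem form_skew_eq_zero {x y : V} (h : S.form x y = 0) : S.form y x = 0 := by
  rw [S.form_skew, h, star_zero, neg_zero]

/-- The submodule `⟨v_j | j > i⟩` of `N`, encoded by the vanishing of the other coordinates. -/
def upperV (i : Fin n) : Submodule Aᵐᵒᵖ V :=
  S.spanV ⊓ ⨅ j ∈ Set.Iic i, LinearMap.ker (S.form (S.u j))

theorem mem_upperV {i : Fin n} {x : V} :
    x ∈ S.upperV i ↔ x ∈ S.spanV ∧ ∀ j ≤ i, S.form (S.u j) x = 0 := by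
  simp [upperV]

/-! ### The groups `C`, `L` and `C ⋊ H` for `H ≤ L` -/

/-- `L` acts on `N` by unitriangular matrices. -/
theorem map_v_sub_mem_upperV {g : V ≃ₗ[Aᵐᵒᵖ] V} (hg : g ∈ S.L) (i : Fin n) :
    g (S.v i) - S.v i ∈ S.upperV i := by
  refine S.mem_upperV.2 ⟨sub_mem (map_mem_of_globalStab hg.1.2 (S.v_mem i)) (S.v_mem i),
    fun j hj => ?_⟩
  have h1 : S.form (g⁻¹ (S.u j) - S.u j) (S.v i) = 0 :=
    S.form_zero_of_span (s := S.u '' Set.Iio j) (t := {S.v i})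
      (by
        rintro _ ⟨k, hk, rfl⟩ _ rfl
        rw [form_u_v, if_neg (lt_of_lt_of_le hk hj).ne])
      ((inv_mem hg).2 j) (Submodule.mem_span_singleton_self _)
  have h2 : S.form (S.u j) (g (S.v i)) = S.form (g⁻¹ (S.u j)) (S.v i) := by
    rw [← hg.1.1.1 (g⁻¹ (S.u j)) (S.v i)]
    exact congrArg (S.form · _) (g.apply_symm_apply (S.u j)).symm
  have h3 : g⁻¹ (S.u j) = (g⁻¹ (S.u j) - S.u j) + S.u j := by abel
  rw [map_sub, h2, h3, form_add_left, h1, zero_add, sub_self]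

theorem map_eq_of_mem_C {g : V ≃ₗ[Aᵐᵒᵖ] V} (hg : g ∈ S.C) {x : V} (hx : x ∈ S.spanU) : g x = x :=
  (mem_fixingSubgroup_iff _).1 hg.2 x hx

/-- An element fixing `M` pointwise moves each `v_i` by an element of `M`, and one of `L` moves it
by an element of `N`. -/
theorem C_inf_L : S.C ⊓ S.L = ⊥ := by
  refine (Subgroup.eq_bot_iff_forall _).2 fun g ⟨hC, hL⟩ => ?_
  refine LinearEquiv.toLinearMap_injective (S.basis.ext ?_)
  rintro (i | i)
  · exact S.map_eq_of_mem_C hC (S.u_mem i)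
  · refine sub_eq_zero.1 (S.eq_zero_of_mem_spanV
      (S.mem_upperV.1 (S.map_v_sub_mem_upperV hL i)).1 fun j => ?_)
    change S.form _ (g (S.v i) - S.v i) = 0
    have h1 := hC.1 (S.u j) (S.v i)
    rw [S.map_eq_of_mem_C hC (S.u_mem j)] at h1
    rw [map_sub, h1, sub_self]

theorem conj_mem_C {g k : V ≃ₗ[Aᵐᵒᵖ] V} (hg : g ∈ S.isometryGroup ⊓ globalStab S.spanU)
    (hk : k ∈ S.C) : g * k * g⁻¹ ∈ S.C := by
  refine ⟨mul_mem (mul_mem hg.1 hk.1) (S.isometryGroup.inv_mem hg.1),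
    (mem_fixingSubgroup_iff _).2 fun x hx => ?_⟩
  change g (k (g⁻¹ x)) = x
  rw [S.map_eq_of_mem_C hk (map_mem_of_globalStab ((globalStab _).inv_mem hg.2) hx)]
  exact g.apply_symm_apply x

theorem C_le_isometryGroup_inf_globalStab : S.C ≤ S.isometryGroup ⊓ globalStab S.spanU :=
  fun _ hg => ((S.CL_le_auxGroup 0) (Subgroup.mem_sup_left hg)).1

theorem L_le_isometryGroup_inf_globalStab : S.L ≤ S.isometryGroup ⊓ globalStab S.spanU :=
  fun _ hg => hg.1.1

/-- An element of `C ⋊ H`, for `H ≤ L`, is a product of an element of `C` and one of `H`. -/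
theorem exists_mul_of_mem_C_sup {H : Subgroup (V ≃ₗ[Aᵐᵒᵖ] V)} (hH : H ≤ S.L) {g : V ≃ₗ[Aᵐᵒᵖ] V}
    (hg : g ∈ S.C ⊔ H) : ∃ c ∈ S.C, ∃ l ∈ H, c * l = g := by
  have hn : H ≤ Subgroup.normalizer (S.C : Set _) := fun l hl => by
    have h1 := S.L_le_isometryGroup_inf_globalStab (hH hl)
    refine Subgroup.mem_normalizer_iff.2 fun k => ⟨S.conj_mem_C h1, fun hk => ?_⟩
    have := S.conj_mem_C (inv_mem h1) hk
    group at this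
    simpa using this
  rw [← SetLike.mem_coe, Subgroup.coe_mul_of_right_le_normalizer_left _ _ hn] at hg
  obtain ⟨c, hc, l, hl, h⟩ := hg
  exact ⟨c, hc, l, hl, h⟩

/-- The `L`-component of an element of `C ⋊ L_w` lies in `L_w`, by uniqueness of the decomposition
in `C ⋊ L`. -/
theorem mem_stabL_of_mul_mem_CL {c l : V ≃ₗ[Aᵐᵒᵖ] V} {w : V} (hc : c ∈ S.C) (hl : l ∈ S.L)
    (h : c * l ∈ S.CL w) : l ∈ S.stabL w := by
  obtain ⟨c', hc', l', hl', e⟩ := S.exists_mul_of_mem_C_sup inf_le_left h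
  have h1 : c'⁻¹ * c = l' * l⁻¹ := by
    rw [eq_mul_inv_iff_mul_eq, mul_assoc, ← e, inv_mul_cancel_left]
  have h2 : c'⁻¹ * c ∈ S.C ⊓ S.L :=
    ⟨mul_mem (S.C.inv_mem hc') hc, h1 ▸ mul_mem hl'.1 (S.L.inv_mem hl)⟩
  rw [C_inf_L, Subgroup.mem_bot, h1, mul_inv_eq_one] at h2
  exact h2 ▸ hl'

theorem isInternalSemidirect_C_LD (D : Finset (Fin n)) :
    IsInternalSemidirect S.C (S.LD D) (S.MD D) :=
  ⟨rfl, le_bot_iff.1 ((inf_le_inf_left _ inf_le_left).trans S.C_inf_L.le), fun _ hg _ hk =>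
    S.conj_mem_C (sup_le S.C_le_isometryGroup_inf_globalStab
      (inf_le_left.trans S.L_le_isometryGroup_inf_globalStab) hg) hk⟩

theorem LD_eq_iInf {D : Finset (Fin n)} (hD : D.Nonempty) :
    S.LD D = ⨅ i ∈ D, S.stabL (S.v i) := by
  obtain ⟨i₀, hi₀⟩ := hD
  ext g
  simp only [LD, stabL, Subgroup.mem_iInf, Subgroup.mem_inf, mem_fixingSubgroup_iff,
    Set.forall_mem_image, Set.mem_singleton_iff, forall_eq, Finset.mem_coe]
  exact ⟨fun h i hi => ⟨h.1, h.2 hi⟩, fun h => ⟨(h i₀ hi₀).1, fun i hi => (h i hi).2⟩⟩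

theorem MD_eq_iInf {D : Finset (Fin n)} (hD : D.Nonempty) :
    S.MD D = ⨅ i ∈ D, S.CL (S.v i) := by
  refine le_antisymm (le_iInf₂ fun i hi => S.MD_le_CL hi) fun g hg => ?_
  have hg' : ∀ i ∈ D, g ∈ S.CL (S.v i) := by simpa only [Subgroup.mem_iInf] using hg
  obtain ⟨i₀, hi₀⟩ := id hD
  obtain ⟨c, hc, l, hl, rfl⟩ := S.exists_mul_of_mem_C_sup inf_le_left (hg' i₀ hi₀)
  refine mul_mem (Subgroup.mem_sup_left hc) (Subgroup.mem_sup_right ?_)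
  rw [S.LD_eq_iInf hD]
  simp only [Subgroup.mem_iInf]
  exact fun i hi => S.mem_stabL_of_mul_mem_CL hc hl.1 (hg' i hi)

/-! ### Eichler transvections and transitivity -/

open MulOpposite in
theorem form_smul_left (a : A) (x y : V) : S.form (op a • x) y = star a * S.form x y := by
  rw [S.form_skew y, S.form_skew y, map_smul, op_smul_eq_mul, star_mul, mul_neg]

open MulOpposite in
theorem form_smul_right (a : A) (x y : V) : S.form x (op a • y) = S.form x y * a := by
  rw [map_smul, op_smul_eq_mul]

open MulOpposite in
/-- The coordinates of a vector of `N` are its values under the forms `h(u_i, -)`. -/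
theorem sum_form_u_smul_v {x : V} (hx : x ∈ S.spanV) :
    ∑ i, op (S.form (S.u i) x) • S.v i = x := by
  refine sub_eq_zero.1 (S.eq_zero_of_mem_spanV (sub_mem (sum_mem fun i _ =>
    Submodule.smul_mem _ _ (S.v_mem i)) hx) fun j => ?_)
  simp [form_u_v]

open MulOpposite in
/-- The linear map `y ↦ y + x h(w, y) + w h(x, y)`, for vectors `w` and `x`. -/
def eichlerMap (w x : V) : V →ₗ[Aᵐᵒᵖ] V where
  toFun y := y + op (S.form w y) • x + op (S.form x y) • w
  map_add' y z := by
    simp only [map_add, op_add, add_smul]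
    abel
  map_smul' a y := by
    have h (z : V) : op (S.form z (a • y)) = a * op (S.form z y) := by
      rw [map_smul]
      rfl
    simp only [h, mul_smul, smul_add, RingHom.id_apply]

open MulOpposite in
theorem eichlerMap_apply (w x y : V) :
    S.eichlerMap w x y = y + op (S.form w y) • x + op (S.form x y) • w := rfl

theorem form_eichlerMap_eichlerMap {w x : V} (hww : S.form w w = 0) (hwx : S.form w x = 0)
    (hxx : S.form x x = 0) (y z : V) :
    S.form (S.eichlerMap w x y) (S.eichlerMap w x z) = S.form y z := by
  have hxw := S.form_skew_eq_zero hwx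
  have h (t : V) : star (S.form t y) = - S.form y t := by rw [S.form_skew t y, neg_neg]
  simp only [eichlerMap_apply, form_add_left, map_add, form_smul_left, form_smul_right, hww, hwx,
    hxx, hxw, h]
  simp

theorem eichlerMap_eichlerMap_neg {w x : V} (hww : S.form w w = 0) (hwx : S.form w x = 0)
    (hxx : S.form x x = 0) (y : V) :
    S.eichlerMap w x (S.eichlerMap w (-x) y) = y := by
  have hxw := S.form_skew_eq_zero hwx
  have h : S.form (-x) y = -S.form x y := by
    simpa using S.form_smul_left (-1) x y
  simp only [eichlerMap_apply, map_add, form_smul_right, map_neg, hww, hwx, hxx, hxw, h]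
  simp [add_assoc]

/-- The Eichler transvection `y ↦ y + x h(w, y) + w h(x, y)` attached to orthogonal isotropic
vectors `w` and `x`. -/
def eichler {w x : V} (hww : S.form w w = 0) (hwx : S.form w x = 0) (hxx : S.form x x = 0) :
    V ≃ₗ[Aᵐᵒᵖ] V :=
  LinearEquiv.ofLinearMap (S.eichlerMap w x) (S.eichlerMap w (-x))
    (LinearMap.ext (S.eichlerMap_eichlerMap_neg hww hwx hxx))
    (LinearMap.ext fun y => by
      have hxx' : S.form (-x) (-x) = 0 := by
        have := S.form_smul_left (-1) x (-x)
        simpa [hxx] using this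
      have := S.eichlerMap_eichlerMap_neg hww (x := -x) (by simp [hwx]) hxx' y
      rwa [neg_neg] at this)

/-- For `x ∈ ⟨v_j | j > i⟩` the group `L` contains an element which maps `v_i` to `v_i + x` and
fixes all other `v_j`. -/
theorem exists_mem_L_of_mem_upperV {i : Fin n} {x : V} (hx : x ∈ S.upperV i) :
    ∃ g ∈ S.L, g (S.v i) = S.v i + x ∧ ∀ j, j ≠ i → g (S.v j) = S.v j := by
  have hxx (z : V) (hz : z ∈ S.upperV i) : S.form z z = 0 := S.form_spanV hz.1 hz.1
  have hux (z : V) (hz : z ∈ S.upperV i) : S.form (S.u i) z = 0 := (S.mem_upperV.1 hz).2 i le_rfl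
  have hv (z : V) (hz : z ∈ S.upperV i) (y : V) (hy : y ∈ S.spanV) :
      S.eichlerMap (S.u i) z y ∈ S.spanV := by
    rw [eichlerMap_apply, S.form_spanV hz.1 hy, MulOpposite.op_zero, zero_smul, add_zero]
    exact add_mem hy (Submodule.smul_mem _ _ hz.1)
  have hu (z : V) (y : V) (hy : y ∈ S.spanU) : S.eichlerMap (S.u i) z y ∈ S.spanU := by
    rw [eichlerMap_apply, S.form_spanU (S.u_mem i) hy, MulOpposite.op_zero, zero_smul, add_zero]
    exact add_mem hy (Submodule.smul_mem _ _ (S.u_mem i))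
  have hvj (j : Fin n) : S.eichlerMap (S.u i) x (S.v j) = S.v j + if i = j then x else 0 := by
    rw [eichlerMap_apply, S.form_spanV hx.1 (S.v_mem j), form_u_v]
    split_ifs <;> simp
  let g := S.eichler (S.form_u_u i i) (hux x hx) (hxx x hx)
  refine ⟨g, ⟨⟨⟨S.form_eichlerMap_eichlerMap (S.form_u_u i i) (hux x hx) (hxx x hx),
    mem_globalStab (hu x) (hu (-x))⟩, mem_globalStab (hv x hx) (hv (-x) (neg_mem hx))⟩,
    fun j => ?_⟩, ?_, fun j hj => ?_⟩
  · change S.eichlerMap (S.u i) x (S.u j) - S.u j ∈ S.spanLT j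
    rw [eichlerMap_apply, form_u_u, MulOpposite.op_zero, zero_smul, add_zero, add_sub_cancel_left]
    by_cases hij : i < j
    · exact Submodule.smul_mem _ _ (S.u_mem_spanLT hij)
    · rw [S.form_skew_eq_zero ((S.mem_upperV.1 hx).2 j (not_lt.1 hij)), MulOpposite.op_zero,
        zero_smul]
      exact zero_mem _
  · exact (hvj i).trans (by rw [if_pos rfl])
  · exact (hvj j).trans (by rw [if_neg hj.symm, add_zero])

/-- `L` acts simultaneously transitively on the cosets `v_i + ⟨v_j | j > i⟩`. -/
theorem exists_mem_L_forall_map_v {x : Fin n → V} (hx : ∀ i, x i ∈ S.upperV i) :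
    ∃ g ∈ S.L, ∀ i, g (S.v i) = S.v i + x i := by
  -- Compose on the right with the transvection that moves `v_k`, for `k = 0, 1, …` in turn: as
  -- `x i` lies in the span of later basis vectors, the previous factors do not change it.
  suffices h : ∀ k : ℕ, ∃ g ∈ S.L, (∀ i : Fin n, (i : ℕ) < k → g (S.v i) = S.v i + x i) ∧
      ∀ i : Fin n, k ≤ i → g (S.v i) = S.v i by
    obtain ⟨g, hg, h1, -⟩ := h n
    exact ⟨g, hg, fun i => h1 i i.2⟩
  intro k
  induction k with
  | zero => exact ⟨1, one_mem _, fun i hi => absurd hi (Nat.not_lt_zero _), fun i _ => rfl⟩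
  | succ k ih =>
    obtain ⟨g, hg, h1, h2⟩ := ih
    by_cases hk : k < n
    · obtain ⟨t, ht, ht1, ht2⟩ := S.exists_mem_L_of_mem_upperV (hx ⟨k, hk⟩)
      refine ⟨g * t, mul_mem hg ht, fun i hi => ?_, fun i hi => ?_⟩
      · change g (t (S.v i)) = _
        rcases Nat.lt_succ_iff_lt_or_eq.1 hi with h | h
        · rw [ht2 i (by rintro rfl; exact lt_irrefl _ h), h1 i h]
        · obtain rfl : i = ⟨k, hk⟩ := Fin.ext h
          have hgx : g (x ⟨k, hk⟩) = x ⟨k, hk⟩ := by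
            rw [← S.sum_form_u_smul_v (hx _).1, map_sum]
            refine Finset.sum_congr rfl fun j _ => ?_
            rw [map_smul]
            rcases le_or_gt k (j : ℕ) with hj | hj
            · rw [h2 j hj]
            · rw [(S.mem_upperV.1 (hx _)).2 j (Fin.mk_le_of_le_val hj.le), MulOpposite.op_zero,
                zero_smul, zero_smul]
          rw [ht1, map_add, h2 _ le_rfl, hgx]
      · change g (t (S.v i)) = _
        rw [ht2 i (by rintro rfl; exact absurd hi (by simp)), h2 i (Nat.le_of_succ_le hi)]
    · exact ⟨g, hg, fun i _ => h1 i (i.2.trans_le (not_lt.1 hk)), fun i hi =>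
        absurd i.2 (by omega)⟩

/-- `P` acts transitively on the product of the coset spaces of the groups `C ⋊ L_{v_i}`. -/
theorem exists_forall_mul_mem_CL {x : Fin n → V ≃ₗ[Aᵐᵒᵖ] V} (hx : ∀ i, x i ∈ S.P) :
    ∃ g ∈ S.P, ∀ i, x i * g ∈ S.CL (S.v i) := by
  choose c hc l hl h using fun i => S.exists_mul_of_mem_C_sup le_rfl (hx i)
  obtain ⟨g, hg, hgv⟩ := S.exists_mem_L_forall_map_v fun i =>
    S.map_v_sub_mem_upperV (S.L.inv_mem (hl i)) i
  refine ⟨g, Subgroup.mem_sup_right hg, fun i => ?_⟩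
  rw [← h i, mul_assoc]
  refine mul_mem (Subgroup.mem_sup_left (hc i)) (Subgroup.mem_sup_right
    ⟨mul_mem (hl i) hg, (mem_fixingSubgroup_iff _).2 ?_⟩)
  rintro _ rfl
  change l i (g (S.v i)) = S.v i
  rw [hgv, add_sub_cancel]
  exact (l i).apply_symm_apply _

/-- A version of `exists_forall_mul_mem_CL` inside the group `P`, with the index set `D`. -/
theorem exists_mul_mem_CL (D : Finset (Fin n)) (x : D → S.P) :
    ∃ g : S.P, ∀ i : D, (x i : V ≃ₗ[Aᵐᵒᵖ] V) * g ∈ S.CL (S.v i) := by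
  obtain ⟨g, hg, hgy⟩ := S.exists_forall_mul_mem_CL
    (x := fun i => (Function.extend Subtype.val x (fun _ => 1) i : S.P)) fun i => Subtype.prop _
  refine ⟨⟨g, hg⟩, fun i => ?_⟩
  have := hgy i
  rwa [Subtype.val_injective.extend_apply] at this

theorem chiD_eq_prod_chi {F : Type*} [Field F] {D : Finset (Fin n)} (lam : D → AddChar A Fˣ)
    (g : S.MD D) : S.chiD D lam g =
      ∏ i : D, S.chi (S.v i) (S.v_mem i) (lam i) (Subgroup.inclusion (S.MD_le_CL i.2) g) := by
  have chi_apply (i : D) (k : S.CL (S.v i)) : S.chi (S.v i) (S.v_mem i) (lam i) k =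
      lam i (S.form ((k : V ≃ₗ[Aᵐᵒᵖ] V) (S.v i)) (S.v i)) := rfl
  simp only [chi_apply, Subgroup.coe_inclusion]
  rfl

end SkewHermitianSpace

end

theorem theorem5p2 {A : Type*} [Ring A] [Nontrivial A] [StarRing A]
    {V : Type*} [AddCommGroup V] [Module Aᵐᵒᵖ V] {F : Type*} [Field F] {n : ℕ}
    (S : SkewHermitianSpace A V n) (D : Finset (Fin n)) (hD : D.Nonempty)
    (lam : D → AddChar A Fˣ) (hlam : ∀ i, LeftAdmissible (lam i)) :
    IsInternalSemidirect S.C (S.LD D) (S.MD D) ∧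
    S.LD D = ⨅ i ∈ D, S.stabL (S.v i) ∧
    S.MD D = ⨅ i ∈ D, S.CL (S.v i) ∧
    Nonempty ((S.repVD D lam).Equiv (S.repInd D lam)) := by
  refine ⟨S.isInternalSemidirect_C_LD D, S.LD_eq_iInf hD, S.MD_eq_iInf hD, ?_⟩
  refine Representation.nonempty_equiv_piTensorRep_ind_of_le
    (fun i : D => S.CL_le_P (S.v i)) (S.MD_le_P D) (fun i => S.MD_le_CL i.2) (fun x hx => ?_)
    (fun i => S.chi (S.v i) (S.v_mem i) (lam i)) (S.chiD D lam)
    (S.chiD_eq_prod_chi lam)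
    (S.exists_mul_mem_CL D)
  rw [S.MD_eq_iInf hD]
  simp only [Subgroup.mem_iInf]
  exact fun i hi => hx ⟨i, hi⟩
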